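/- **Persistent Excision Theorem.** Let $\mathbb K$ be a field, let $X$ be a triangulable topological space (i.e. homeomorphic to the geometric realization of a simplicial complex), and let $A, B \subseteq X$ be nonempty subspaces with $X = A^\circ \cup B^\circ$. Let $P$ be a partially ordered set (for example $P=\mathbb N$). Let $\{X_i\}_{i\in P}$ be a filtration of $X$ (subspaces $X_i\subseteq X$ with $X_i \subseteq X_j$ whenever $i \le j$), and let $\{A_i\}_{i\in P}$ and $\{B_i\}_{i\in P}$ be filtrations of $A$ and of $B$ (so $A_i\subseteq A$, $B_i\subseteq B$) such that for every $i \in P$ we have $A_i, B_i \subseteq X_i$ and $$X_i = A_i^\circ \cup B_i^\circ ,$$ where the interiors are taken in $X_i$ with its subspace topology. Put $(A\cap B)_i = A_i\cap B_i$. Adjoin to $P$ a largest element $\infty$, with $X_\infty = X$, $A_\infty = A$, $B_\infty = B$, $(A\cap B)_\infty = A\cap B$. For $k\in\mathbb N$ let $H_k(-,-)$ be relative singular homology with coefficients in $\mathbb K$, let $\mathcal H_k(X,A)$ be the persistence module $i\mapsto H_k(X_i,A_i)$ and $\mathcal H_k(B,A\cap B)$ the persistence module $i\mapsto H_k(B_i,A_i\cap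 B_i)$ over $P\cup\{\infty\}$, with the linear maps induced by inclusions of pairs, and for $i<j$ let $$H_k^{i,j}(X,A)=\operatorname{im}\bigl(H_k(X_i,A_i)\to H_k(X_j,A_j)\bigr),\qquad H_k^{i,j}(B,A\cap B)=\operatorname{im}\bigl(H_k(B_i,A_i\cap B_i)\to H_k(B_j,A_j\cap B_j)\bigr).$$ Then, for every $k\in\mathbb N$: 1. the inclusions of pairs $(B_i,A_i\cap B_i)\hookrightarrow (X_i,A_i)$ induce an isomorphism of persistence modules $\mathcal H_k(B,A\cap B)\cong\mathcal H_k(X,A)$; 2. for all $i<j$ in $P\cup\{\infty\}$, the map induced by the inclusion $(B_j,A_j\cap B_j)\hookrightarrow (X_j,A_j)$ restricts to an isomorphism of persistent homology groups $H_k^{i,j}(B,A\cap B)\cong H_k^{i,j}(X,A)$. -/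

import Mathlib

open CategoryTheory

universe u v w

namespace PersistentExcision

noncomputable section

/-! ### Triangulable spaces -/

/-- The geometric realization of an abstract simplicial complex `L`: finitely supported families
of nonnegative barycentric coordinates with sum `1` whose support is a simplex of `L`. -/
def Realization {ι : Type u} (L : AbstractSimplicialComplex ι) : Type u :=
  {x : ι →₀ ℝ // (∀ a, 0 ≤ x a) ∧ (x.sum fun _ t => t) = 1 ∧ x.support ∈ L.faces}

/-- The closed simplex of `|L|` spanned by a set `s` of vertices. -/
def Realization.Cell {ι : Type u} (L : AbstractSimplicialComplex ι) (s : Finset ι) : Type u :=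
  {x : Realization L // x.1.support ⊆ s}

/-- The Euclidean topology on a closed simplex, given by its barycentric coordinates (those not
belonging to `s` vanish). -/
instance {ι : Type u} (L : AbstractSimplicialComplex ι) (s : Finset ι) :
    TopologicalSpace (Realization.Cell L s) :=
  TopologicalSpace.induced (fun (x : Realization.Cell L s) (a : ι) => (x.1.1 a : ℝ)) inferInstance

/-- The weak (coherent) topology: a subset of `|L|` is open if and only if its trace on the closed
simplex of every face is open in that simplex. -/
instance {ι : Type u} (L : AbstractSimplicialComplex ι) : TopologicalSpace (Realization L) :=
  ⨆ s : {s : Finset ι // s ∈ L.faces},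
    TopologicalSpace.coinduced (fun x : Realization.Cell L s.1 => x.1) inferInstance

/-- A space is triangulable if it is homeomorphic to the realization of a simplicial complex.
(No finiteness is imposed on the complex.) -/
def IsTriangulable (X : Type u) [TopologicalSpace X] : Prop :=
  ∃ (ι : Type u) (L : AbstractSimplicialComplex ι), Nonempty (X ≃ₜ Realization L)

/-! ### Relative singular homology -/

/-- The relative singular chain complex functor `(X, A) ↦ C(X; K) / C(A; K)`. -/
def relChainComplexFunctor (K : Type v) [Field K] :
    TopPair.{u} ⥤ ChainComplex (ModuleCat.{max u v} K) ℕ :=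
  MorphismProperty.Arrow.forget _ _ _ ⋙
    ((AlgebraicTopology.singularChainComplexFunctor.{u} (ModuleCat.{max u v} K)).obj
      (ModuleCat.of K (ULift.{u} K))).mapArrow ⋙ Limits.coker _

/-- The relative singular homology functor `(X, A) ↦ H_k(X, A; K)`. -/
def relHomologyFunctor (K : Type v) [Field K] (k : ℕ) :
    TopPair.{u} ⥤ ModuleCat.{max u v} K :=
  relChainComplexFunctor K ⋙ HomologicalComplex.homologyFunctor _ _ k

/-! ### Pairs of subspaces of a fixed space -/

/-- A pair `(S, T)` of subsets `T ⊆ S` of `X`, ordered by inclusion of pairs. -/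
def SubPair (X : Type u) : Type u := {p : Set X × Set X // p.2 ⊆ p.1}

instance (X : Type u) : PartialOrder (SubPair X) :=
  inferInstanceAs (PartialOrder {p : Set X × Set X // p.2 ⊆ p.1})

/-- The topological pair given by a pair of subsets with their subspace topologies; inclusions of
pairs are sent to inclusion maps. -/
def SubPair.toTopPair (X : Type u) [TopologicalSpace X] : SubPair X ⥤ TopPair.{u} where
  obj p := TopPair.of (A := TopCat.of p.1.2) (X := TopCat.of p.1.1)
    (TopCat.ofHom ⟨Set.inclusion p.2, continuous_inclusion p.2⟩)
    (Topology.IsEmbedding.inclusion p.2)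
  map {p q} f := TopPair.ofHom
    (TopCat.ofHom ⟨Set.inclusion (leOfHom f).1, continuous_inclusion (leOfHom f).1⟩)
    (TopCat.ofHom ⟨Set.inclusion (leOfHom f).2, continuous_inclusion (leOfHom f).2⟩)
    (by ext x; rfl)
  map_id p := by ext <;> rfl
  map_comp f g := by ext <;> rfl

/-! ### Persistence modules -/

/-- The persistent homology group `M^{i,j}` of a persistence module `M`: the image of
`M_i → M_j`. -/
def persistentGroup {K : Type v} [Field K] {Q : Type w} [PartialOrder Q]
    (M : Q ⥤ ModuleCat.{max u v} K) {i j : Q} (h : i ≤ j) : Submodule K (M.obj j) :=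
  LinearMap.range (M.map (homOfLE h)).hom

/-- The persistence module `i ↦ H_k(S_i, T_i; K)` of an increasing family of pairs
`(S_i, T_i)`, with the maps induced by inclusions. -/
def relPersistenceModule (K : Type v) [Field K] (k : ℕ) {X : Type u} [TopologicalSpace X]
    {Q : Type w} [PartialOrder Q] (F : Q →o SubPair X) : Q ⥤ ModuleCat.{max u v} K :=
  F.monotone.functor ⋙ SubPair.toTopPair X ⋙ relHomologyFunctor K k

/-- The morphism of persistence modules induced by the inclusions of pairs `F i ⊆ G i`. -/
def relPersistenceModuleMap (K : Type v) [Field K] (k : ℕ) {X : Type u} [TopologicalSpace X]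
    {Q : Type w} [PartialOrder Q] {F G : Q →o SubPair X} (h : F ≤ G) :
    relPersistenceModule K k F ⟶ relPersistenceModule K k G :=
  Functor.whiskerRight
    ({ app := fun i => homOfLE (show F i ≤ G i from h i)
       naturality := fun _ _ _ => Subsingleton.elim _ _ } :
      F.monotone.functor ⟶ G.monotone.functor)
    (SubPair.toTopPair X ⋙ relHomologyFunctor K k)

/-! ### Filtrations -/

/-- A filtration, indexed by a partially ordered set `P`, of a subspace `S` of `X`. -/
structure Filtration (P : Type w) [PartialOrder P] {X : Type u} (S : Set X) where
  /-- the subspaces in the filtration -/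
  stage : P →o Set X
  stage_subset : ∀ i, stage i ⊆ S

namespace Filtration

variable {P : Type w} [PartialOrder P] {X : Type u} {S T : Set X}

/-- The filtration `i ↦ S_i ∩ T_i` of `S ∩ T`. -/
def inter (F : Filtration P S) (G : Filtration P T) : Filtration P (S ∩ T) where
  stage := F.stage ⊓ G.stage
  stage_subset i := Set.inter_subset_inter (F.stage_subset i) (G.stage_subset i)

/-- For filtrations of `S` and `T` with `T ⊆ S` and `T_i ⊆ S_i`, the filtration
`(S_i, T_i) ⊆ ⋯ ⊆ (S, T)` of the pair `(S, T)`, including `(S, T)` itself as the terminal stage,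
which has index `⊤`. -/
def pair (F : Filtration P S) (G : Filtration P T) (h : T ⊆ S)
    (hi : ∀ i, G.stage i ⊆ F.stage i) : WithTop P →o SubPair X where
  toFun i := WithTop.recTopCoe (C := fun _ => SubPair X) ⟨(S, T), h⟩
    (fun i => ⟨(F.stage i, G.stage i), hi i⟩) i
  monotone' i j hij := by
    induction j using WithTop.recTopCoe with
    | top =>
      induction i using WithTop.recTopCoe with
      | top => exact le_rfl
      | coe i => exact ⟨F.stage_subset i, G.stage_subset i⟩
    | coe j =>
      induction i using WithTop.recTopCoe with
      | top => simp at hij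
      | coe i =>
        have hij' : i ≤ j := WithTop.coe_le_coe.1 hij
        exact ⟨F.stage.monotone hij', G.stage.monotone hij'⟩

/-- The stagewise inclusions of pairs `(B_i, A_i ∩ B_i) ⊆ (X_i, A_i)` and
`(B, A ∩ B) ⊆ (X, A)`. -/
theorem pair_inter_le {A B : Set X} (FX : Filtration P (Set.univ : Set X)) (FA : Filtration P A)
    (FB : Filtration P B) (hA : ∀ i, FA.stage i ⊆ FX.stage i)
    (hB : ∀ i, FB.stage i ⊆ FX.stage i) :
    FB.pair (FA.inter FB) Set.inter_subset_right (fun _ => Set.inter_subset_right) ≤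
      FX.pair FA (Set.subset_univ A) hA := by
  intro i
  induction i using WithTop.recTopCoe with
  | top => exact ⟨Set.subset_univ _, Set.inter_subset_left⟩
  | coe i => exact ⟨hB i, Set.inter_subset_left⟩

end Filtration

end

end PersistentExcision

/-!
Excision holds for the inclusion `(B_i, A_i ∩ B_i) ⊆ (X_i, A_i)` at every stage of the filtration,
including the terminal one. A natural transformation whose components are isomorphisms is an
isomorphism, and an isomorphism of persistence modules restricts to the images of the structure
maps.

For a single pair, the chain map `C(B) / C(A ∩ B) ⟶ C(X) / C(A)` is injective, because a chain of
`B` whose simplices all lie in `A` is a chain of `A ∩ B`. Its cokernel is `Q = C(X) / (C(A) + C(B))`,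
so by the long exact sequence it suffices that `Q` is acyclic (`isIso_homologyMap_cokernel`).
That is a consequence of barycentric subdivision. For every `m`, the `m`-fold subdivision `S` is
naturally homotopic to the identity, by a homotopy `T` with `c - S c = ∂ T c + T ∂ c`. Naturality
makes `T` preserve `C(A) + C(B)`, and by the Lebesgue number lemma `S c` lies in `C(A) + C(B)`
once `m` is large, as the interiors of `A` and `B` cover `X`. Hence a chain `c` whose boundary lies
in `C(A) + C(B)` is congruent to `∂ T c` (`SingularChain.exists_sub_boundary_mem_supported_succ`).

The formulas for `S` and `T` are proved in the augmented complex of formal combinations of tuples of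
points of a set with a notion of barycenter, where `∂ (b * c) = c - b * ∂ c` for the cone `b * c`
with apex `b`. The recursions are `S w = b * S ∂ w` and `T w = b * (w - T ∂ w)`, with `b` the
barycenter of `w`. Tuples of points of a standard simplex are then read as affine singular simplices, and the
operators are carried to a space by composing with a singular simplex. The chains of Mathlib's
singular chain complex are identified with formal combinations of continuous maps from standard
simplices by `toChain`.
-/

namespace PersistentExcision

/-! ### Chains on tuples of points -/

namespace TupleChain

open Finsupp

section Algebra

variable (R : Type*) [CommRing R] {E F : Type*}

/-- The simplicial boundary on formal combinations of tuples of points of `E`. A tuple of length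
`n` spans a simplex of dimension `n - 1`, so that the complex is augmented by the empty tuple. -/
noncomputable def boundary (n : ℕ) : ((Fin (n + 1) → E) →₀ R) →ₗ[R] ((Fin n → E) →₀ R) :=
  ∑ i : Fin (n + 1), (-1 : R) ^ (i : ℕ) • lmapDomain R R i.removeNth

/-- The cone with apex `b`: the operator which puts `b` in front of a tuple. -/
noncomputable def cone (b : E) (n : ℕ) :
    ((Fin n → E) →₀ R) →ₗ[R] ((Fin (n + 1) → E) →₀ R) :=
  lmapDomain R R (fun w => (Fin.cons b w : Fin (n + 1) → E))

/-- The chain map induced by a map of point sets. -/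
noncomputable def map (f : E → F) (n : ℕ) : ((Fin n → E) →₀ R) →ₗ[R] ((Fin n → F) →₀ R) :=
  lmapDomain R R (f ∘ ·)

variable {R}

lemma boundary_single {n : ℕ} (w : Fin (n + 1) → E) (r : R) :
    boundary R n (single w r) =
      ∑ i : Fin (n + 1), (-1 : R) ^ (i : ℕ) • single (i.removeNth w) r := by
  simp [boundary]

@[simp]
lemma cone_single (b : E) {n : ℕ} (w : Fin n → E) (r : R) :
    cone R b n (single w r) = single (Fin.cons b w : Fin (n + 1) → E) r := by
  simp [cone]

@[simp]
lemma map_single (f : E → F) {n : ℕ} (w : Fin n → E) (r : R) :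
    map R f n (single w r) = single (f ∘ w) r := by
  simp [map]

lemma boundary_map (f : E → F) {n : ℕ} (c : (Fin (n + 1) → E) →₀ R) :
    boundary R n (map R f (n + 1) c) = map R f n (boundary R n c) := by
  induction c using Finsupp.induction_linear with
  | zero => simp
  | add c d hc hd => simp only [map_add, hc, hd]
  | single w r =>
    simp only [map_single, boundary_single, map_sum, map_smul]
    rfl

lemma map_cone (f : E → F) (b : E) {n : ℕ} (c : (Fin n → E) →₀ R) :
    map R f (n + 1) (cone R b n c) = cone R (f b) n (map R f n c) := by
  induction c using Finsupp.induction_linear with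
  | zero => simp
  | add c d hc hd => simp only [map_add, hc, hd]
  | single w r =>
    simp only [map_single, cone_single]
    congr 1
    ext i
    cases i using Fin.cases <;> rfl

lemma boundary_cone_zero (b : E) (c : (Fin 0 → E) →₀ R) :
    boundary R 0 (cone R b 0 c) = c := by
  induction c using Finsupp.induction_linear with
  | zero => simp
  | add c d hc hd => simp only [map_add, hc, hd]
  | single w r =>
    simp only [cone_single, boundary_single]
    simp [Subsingleton.elim _ w]

lemma boundary_cone (b : E) {n : ℕ} (c : (Fin (n + 1) → E) →₀ R) :
    boundary R (n + 1) (cone R b (n + 1) c) = c - cone R b n (boundary R n c) := by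
  induction c using Finsupp.induction_linear with
  | zero => simp
  | add c d hc hd => simp only [map_add, hc, hd]; abel
  | single w r =>
    simp only [cone_single, boundary_single, map_sum, map_smul]
    rw [Fin.sum_univ_succ, sub_eq_add_neg, ← Finset.sum_neg_distrib]
    congr 1
    · simp
    · refine Finset.sum_congr rfl fun i _ => ?_
      have : (i.succ.removeNth (Fin.cons b w : Fin (n + 2) → E)) = Fin.cons b (i.removeNth w) := by
        ext j
        cases j using Fin.cases <;> simp [Fin.removeNth]
      rw [this, Fin.val_succ, pow_succ]
      simp

lemma boundary_boundary {n : ℕ} (c : (Fin (n + 2) → E) →₀ R) :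
    boundary R n (boundary R (n + 1) c) = 0 := by
  induction n with
  | zero =>
    induction c using Finsupp.induction_linear with
    | zero => simp
    | add c d hc hd => simp only [map_add, hc, hd, add_zero]
    | single w r =>
      rw [← Fin.cons_self_tail w, ← cone_single, boundary_cone, map_sub, boundary_cone_zero,
        sub_self]
  | succ n ih =>
    induction c using Finsupp.induction_linear with
    | zero => simp
    | add c d hc hd => simp only [map_add, hc, hd, add_zero]
    | single w r =>
      rw [← Fin.cons_self_tail w, ← cone_single, boundary_cone, map_sub, boundary_cone, ih,
        map_zero, sub_zero, sub_self]

variable (R) (β : ∀ n : ℕ, (Fin (n + 1) → E) → E) (γ : ∀ n : ℕ, (Fin (n + 1) → F) → F)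

/-- Subdivision of tuples with respect to a choice `β` of barycenters: the subdivision of a simplex
is the cone, from its barycenter, over the subdivision of its boundary. -/
noncomputable def subdiv : ∀ n : ℕ, Module.End R ((Fin n → E) →₀ R)
  | 0 => LinearMap.id
  | n + 1 => linearCombination R fun w => cone R (β n w) n (subdiv n (boundary R n (single w 1)))

/-- The chain homotopy between the identity and the subdivision. It vanishes on the empty tuple, so
that the homotopy formula in dimension `0` has no contribution from the augmentation. -/
noncomputable def subdivHomotopy :
    ∀ n : ℕ, ((Fin n → E) →₀ R) →ₗ[R] ((Fin (n + 1) → E) →₀ R)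
  | 0 => 0
  | n + 1 => linearCombination R fun w =>
      cone R (β n w) (n + 1) (single w 1 - subdivHomotopy n (boundary R n (single w 1)))

variable {R}

lemma subdiv_single {n : ℕ} (w : Fin (n + 1) → E) (r : R) :
    subdiv R β (n + 1) (single w r) =
      cone R (β n w) n (subdiv R β n (boundary R n (single w r))) := by
  rw [subdiv, linearCombination_single, ← map_smul, ← map_smul, ← map_smul, smul_single_one]

lemma subdivHomotopy_single {n : ℕ} (w : Fin (n + 1) → E) (r : R) :
    subdivHomotopy R β (n + 1) (single w r) =
      cone R (β n w) (n + 1) (single w r - subdivHomotopy R β n (boundary R n (single w r))) := by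
  rw [subdivHomotopy, linearCombination_single, ← map_smul, smul_sub, ← map_smul, ← map_smul,
    smul_single_one]

lemma boundary_subdiv {n : ℕ} (c : (Fin (n + 1) → E) →₀ R) :
    boundary R n (subdiv R β (n + 1) c) = subdiv R β n (boundary R n c) := by
  induction n with
  | zero =>
    induction c using Finsupp.induction_linear with
    | zero => simp
    | add c d hc hd => simp only [map_add, hc, hd]
    | single w r => rw [subdiv_single, boundary_cone_zero]
  | succ n ih =>
    induction c using Finsupp.induction_linear with
    | zero => simp
    | add c d hc hd => simp only [map_add, hc, hd]
    | single w r =>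
      rw [subdiv_single, boundary_cone, ih, boundary_boundary, map_zero, map_zero, sub_zero]

lemma boundary_subdivHomotopy {n : ℕ} (c : (Fin (n + 1) → E) →₀ R) :
    boundary R (n + 1) (subdivHomotopy R β (n + 1) c) + subdivHomotopy R β n (boundary R n c) =
      c - subdiv R β (n + 1) c := by
  induction n with
  | zero =>
    induction c using Finsupp.induction_linear with
    | zero => simp
    | add c d hc hd =>
      simp only [map_add]
      rw [add_add_add_comm, hc, hd]; abel
    | single w r =>
      rw [subdivHomotopy_single, subdiv_single, boundary_cone]
      simp [subdivHomotopy, subdiv]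
  | succ n ih =>
    induction c using Finsupp.induction_linear with
    | zero => simp
    | add c d hc hd =>
      simp only [map_add]
      rw [add_add_add_comm, hc, hd]; abel
    | single w r =>
      have h := ih (boundary R (n + 1) (single w r))
      rw [boundary_boundary, map_zero, add_zero] at h
      rw [subdivHomotopy_single, subdiv_single, boundary_cone, map_sub (boundary R (n + 1)), h,
        sub_sub_cancel]
      abel

variable {β γ}

lemma map_subdiv {f : E → F} (hf : ∀ n w, f (β n w) = γ n (f ∘ w)) {n : ℕ}
    (c : (Fin n → E) →₀ R) :
    map R f n (subdiv R β n c) = subdiv R γ n (map R f n c) := by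
  induction n with
  | zero => rfl
  | succ n ih =>
    induction c using Finsupp.induction_linear with
    | zero => simp
    | add c d hc hd => simp only [map_add, hc, hd]
    | single w r =>
      rw [subdiv_single, map_cone, ih, hf, ← boundary_map, map_single, subdiv_single]

lemma map_subdivHomotopy {f : E → F} (hf : ∀ n w, f (β n w) = γ n (f ∘ w)) {n : ℕ}
    (c : (Fin n → E) →₀ R) :
    map R f (n + 1) (subdivHomotopy R β n c) = subdivHomotopy R γ n (map R f n c) := by
  induction n with
  | zero => simp [subdivHomotopy]
  | succ n ih =>
    induction c using Finsupp.induction_linear with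
    | zero => simp
    | add c d hc hd => simp only [map_add, hc, hd]
    | single w r =>
      rw [subdivHomotopy_single, map_cone, map_sub, ih, hf, ← boundary_map, map_single,
        subdivHomotopy_single]

variable (R β)

/-- The chain homotopy between the identity and the `m`-fold subdivision. -/
noncomputable def iterHomotopy (m n : ℕ) : ((Fin n → E) →₀ R) →ₗ[R] ((Fin (n + 1) → E) →₀ R) :=
  ∑ i ∈ Finset.range m, subdivHomotopy R β n ∘ₗ (subdiv R β n ^ i)

variable {R}

lemma iterHomotopy_zero (m : ℕ) : iterHomotopy R β m 0 = 0 := by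
  simp [iterHomotopy, subdivHomotopy]

lemma boundary_subdiv_pow (m : ℕ) {n : ℕ} (c : (Fin (n + 1) → E) →₀ R) :
    boundary R n ((subdiv R β (n + 1) ^ m) c) = (subdiv R β n ^ m) (boundary R n c) := by
  induction m with
  | zero => simp
  | succ m ih => simp only [pow_succ', Module.End.mul_apply, boundary_subdiv, ih]

lemma boundary_iterHomotopy (m : ℕ) {n : ℕ} (c : (Fin (n + 1) → E) →₀ R) :
    boundary R (n + 1) (iterHomotopy R β m (n + 1) c) + iterHomotopy R β m n (boundary R n c) =
      c - (subdiv R β (n + 1) ^ m) c := by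
  induction m with
  | zero => simp [iterHomotopy]
  | succ m ih =>
    have h := boundary_subdivHomotopy β ((subdiv R β (n + 1) ^ m) c)
    simp only [iterHomotopy, Finset.sum_range_succ, LinearMap.add_apply, map_add] at ih ⊢
    rw [add_add_add_comm, ih, LinearMap.comp_apply, LinearMap.comp_apply, ← boundary_subdiv_pow,
      h, pow_succ', Module.End.mul_apply]
    abel

variable {β}

lemma map_subdiv_pow {f : E → F} (hf : ∀ n w, f (β n w) = γ n (f ∘ w)) (m : ℕ) {n : ℕ}
    (c : (Fin n → E) →₀ R) :
    map R f n ((subdiv R β n ^ m) c) = (subdiv R γ n ^ m) (map R f n c) := by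
  induction m with
  | zero => simp
  | succ m ih => simp only [pow_succ', Module.End.mul_apply, map_subdiv hf, ih]

lemma map_iterHomotopy {f : E → F} (hf : ∀ n w, f (β n w) = γ n (f ∘ w)) (m : ℕ) {n : ℕ}
    (c : (Fin n → E) →₀ R) :
    map R f (n + 1) (iterHomotopy R β m n c) = iterHomotopy R γ m n (map R f n c) := by
  simp only [iterHomotopy, LinearMap.sum_apply, map_sum, LinearMap.comp_apply,
    map_subdivHomotopy hf, map_subdiv_pow hf]

end Algebra

section Supported

variable {R : Type*} [CommRing R] {α M : Type*} [AddCommGroup M] [Module R M]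

/-- A linear map sends chains supported in `s` to `N` if it does so for the generators. -/
lemma map_mem_of_mem_supported {s : Set α} {f : (α →₀ R) →ₗ[R] M} {N : Submodule R M}
    (h : ∀ a ∈ s, f (single a 1) ∈ N) {c : α →₀ R} (hc : c ∈ supported R R s) : f c ∈ N := by
  have : supported R R s ≤ N.comap f := by
    rw [supported_eq_span_single, Submodule.span_le]
    rintro _ ⟨a, ha, rfl⟩
    exact h a ha
  exact this hc

end Supported

section Small

variable {R : Type*} [CommRing R] {E : Type*} {β : ∀ n : ℕ, (Fin (n + 1) → E) → E}

lemma boundary_mem_supported {n : ℕ} {s : Set (Fin (n + 1) → E)} {t : Set (Fin n → E)}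
    (h : ∀ w ∈ s, ∀ i : Fin (n + 1), i.removeNth w ∈ t) {c : (Fin (n + 1) → E) →₀ R}
    (hc : c ∈ supported R R s) : boundary R n c ∈ supported R R t := by
  refine map_mem_of_mem_supported (fun w hw => ?_) hc
  rw [boundary_single]
  exact Submodule.sum_mem _ fun i _ =>
    Submodule.smul_mem _ _ (single_mem_supported R 1 (h w hw i))

lemma cone_mem_supported (b : E) {n : ℕ} {s : Set (Fin n → E)} {t : Set (Fin (n + 1) → E)}
    (h : ∀ w ∈ s, (Fin.cons b w : Fin (n + 1) → E) ∈ t) {c : (Fin n → E) →₀ R}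
    (hc : c ∈ supported R R s) : cone R b n c ∈ supported R R t := by
  refine map_mem_of_mem_supported (fun w hw => ?_) hc
  rw [cone_single]
  exact single_mem_supported R 1 (h w hw)

/-- Subdivision does not leave a set which is closed under barycenters. -/
lemma subdiv_mem_supported_of_closed {s : Set E}
    (hs : ∀ n w, (∀ i, w i ∈ s) → β n w ∈ s) {n : ℕ} {c : (Fin n → E) →₀ R}
    (hc : c ∈ supported R R {w | ∀ i, w i ∈ s}) :
    subdiv R β n c ∈ supported R R {w | ∀ i, w i ∈ s} := by
  induction n with
  | zero => exact hc
  | succ n ih =>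
    refine map_mem_of_mem_supported (fun w hw => ?_) hc
    rw [subdiv_single]
    refine cone_mem_supported _ (s := {w | ∀ i, w i ∈ s}) ?_ (ih (boundary_mem_supported
      (s := {w | ∀ i, w i ∈ s}) (t := {w | ∀ i, w i ∈ s}) (fun w hw i j => hw _)
      (single_mem_supported R 1 hw)))
    intro v hv i
    cases i using Fin.cases with
    | zero => exact hs n w hw
    | succ i => exact hv i

variable [PseudoMetricSpace E]

/-- Subdivision shrinks the mutual distances of the vertices of a simplex of dimension `n` by the
factor `n / (n + 1)`. Of the ambient geometry this only uses that balls are closed under barycenters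
and that a barycenter has distance at most `n / (n + 1)` of the diameter to each vertex: vertices
of the subdivided boundary then lie in the ball of that radius around the new apex. -/
lemma subdiv_mem_supported_of_dist
    (hball : ∀ (x : E) (r : ℝ) (n : ℕ) (w : Fin (n + 1) → E),
      (∀ i, w i ∈ Metric.closedBall x r) → β n w ∈ Metric.closedBall x r)
    (hβ : ∀ (n : ℕ) (w : Fin (n + 1) → E) (d : ℝ), (∀ i j, dist (w i) (w j) ≤ d) →
      ∀ i, dist (w i) (β n w) ≤ n / (n + 1) * d)
    {n : ℕ} {d : ℝ} {c : (Fin (n + 1) → E) →₀ R}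
    (hc : c ∈ supported R R {w | ∀ i j, dist (w i) (w j) ≤ d}) :
    subdiv R β (n + 1) c ∈
      supported R R {w | ∀ i j, dist (w i) (w j) ≤ n / (n + 1) * d} := by
  induction n with
  | zero =>
    refine map_mem_of_mem_supported (fun w hw => ?_) hc
    rw [subdiv_single]
    refine cone_mem_supported _ (s := Set.univ) ?_ (by simp)
    intro v _ i j
    rw [Fin.fin_one_eq_zero i, Fin.fin_one_eq_zero j]
    simp
  | succ n ih =>
    refine map_mem_of_mem_supported (fun w hw => ?_) hc
    rw [subdiv_single]
    have hd : 0 ≤ d := dist_nonneg.trans (hw 0 0)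
    set b := β (n + 1) w
    set r : ℝ := ((n + 1 : ℕ) : ℝ) / ((n + 1 : ℕ) + 1) * d with hr
    have hr0 : 0 ≤ r := by positivity
    have hle : (n : ℝ) / (n + 1) * d ≤ r := by
      rw [hr]
      gcongr ?_ * d
      rw [div_le_div_iff₀ (by positivity) (by positivity)]
      push_cast
      nlinarith
    have hw1 := single_mem_supported R (1 : R) hw
    have hw2 : single w (1 : R) ∈ supported R R {w | ∀ i, w i ∈ Metric.closedBall b r} :=
      single_mem_supported R (1 : R) (hβ (n + 1) w d hw)
    have h1 := ih (boundary_mem_supported (s := {w | ∀ i j, dist (w i) (w j) ≤ d})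
      (t := {w | ∀ i j, dist (w i) (w j) ≤ d}) (fun w hw i j k => hw _ _) hw1)
    have h2 := subdiv_mem_supported_of_closed (β := β) (hball b r) (boundary_mem_supported
      (s := {w | ∀ i, w i ∈ Metric.closedBall b r}) (t := {w | ∀ i, w i ∈ Metric.closedBall b r})
      (fun w hw i j => hw _) hw2)
    have h3 := Submodule.mem_inf.2 ⟨h1, h2⟩
    rw [← supported_inter] at h3
    refine cone_mem_supported _ ?_ h3
    rintro v ⟨hv1, hv2⟩ i j
    cases i using Fin.cases with
    | zero =>
      cases j using Fin.cases with
      | zero => simpa using hr0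
      | succ j => rw [dist_comm]; exact hv2 j
    | succ i =>
      cases j using Fin.cases with
      | zero => exact hv2 i
      | succ j => exact (hv1 i j).trans hle

lemma subdiv_pow_mem_supported_of_dist
    (hball : ∀ (x : E) (r : ℝ) (n : ℕ) (w : Fin (n + 1) → E),
      (∀ i, w i ∈ Metric.closedBall x r) → β n w ∈ Metric.closedBall x r)
    (hβ : ∀ (n : ℕ) (w : Fin (n + 1) → E) (d : ℝ), (∀ i j, dist (w i) (w j) ≤ d) →
      ∀ i, dist (w i) (β n w) ≤ n / (n + 1) * d)
    (m : ℕ) {n : ℕ} {d : ℝ} {c : (Fin (n + 1) → E) →₀ R}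
    (hc : c ∈ supported R R {w | ∀ i j, dist (w i) (w j) ≤ d}) :
    (subdiv R β (n + 1) ^ m) c ∈
      supported R R {w | ∀ i j, dist (w i) (w j) ≤ (n / (n + 1)) ^ m * d} := by
  induction m with
  | zero => simpa using hc
  | succ m ih =>
    rw [pow_succ', pow_succ', Module.End.mul_apply, mul_assoc]
    exact subdiv_mem_supported_of_dist hball hβ ih

end Small

end TupleChain

/-! ### Affine simplices in a standard simplex -/

section AffineSimplex

variable {ι κ : Type*} [Fintype ι] [Fintype κ]

/-- The affine map between standard simplices that sends the vertices to the points `w j`. -/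
noncomputable def affineSimplex (w : κ → stdSimplex ℝ ι) :
    C(stdSimplex ℝ κ, stdSimplex ℝ ι) where
  toFun t := ⟨∑ j, t j • (w j : ι → ℝ), (convex_stdSimplex ℝ ι).sum_mem
    (fun j _ => stdSimplex.zero_le t j) (stdSimplex.sum_eq_one t) fun j _ => (w j).2⟩
  continuous_toFun := by
    refine Continuous.subtype_mk (continuous_finsetSum _ fun j _ => ?_) _
    have h : Continuous fun t : stdSimplex ℝ κ => t.1 j :=
      (continuous_apply j).comp continuous_subtype_val
    exact h.smul continuous_const

/-- The map of standard simplices induced by a map of vertices, as a continuous map. -/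
noncomputable def simplexMap (f : κ → ι) : C(stdSimplex ℝ κ, stdSimplex ℝ ι) :=
  ⟨stdSimplex.map f, stdSimplex.continuous_map f⟩

lemma simplexMap_comp_affineSimplex {ι' : Type*} [Fintype ι'] (f : ι → ι')
    (w : κ → stdSimplex ℝ ι) :
    (simplexMap f).comp (affineSimplex w) = affineSimplex (simplexMap f ∘ w) := by
  ext t : 1
  refine Subtype.ext ?_
  change FunOnFinite.linearMap ℝ ℝ f (∑ j, t j • (w j : ι → ℝ)) =
    ∑ j, t j • FunOnFinite.linearMap ℝ ℝ f (w j : ι → ℝ)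
  simp only [map_sum, map_smul]

lemma affineSimplex_comp_simplexMap {κ' : Type*} [Fintype κ'] (f : κ' → κ)
    (w : κ → stdSimplex ℝ ι) :
    (affineSimplex w).comp (simplexMap f) = affineSimplex (w ∘ f) := by
  classical
  ext t : 1
  refine Subtype.ext ?_
  change ∑ j, (FunOnFinite.linearMap ℝ ℝ f t) j • (w j : ι → ℝ) =
    ∑ j, t j • (w (f j) : ι → ℝ)
  simp only [FunOnFinite.linearMap_apply_apply, Finset.sum_smul]
  rw [← Finset.sum_fiberwise Finset.univ f]
  refine Finset.sum_congr rfl fun j _ => Finset.sum_congr rfl fun i hi => ?_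
  rw [(Finset.mem_filter.1 hi).2]

lemma affineSimplex_vertex [DecidableEq ι] :
    affineSimplex (fun i : ι => stdSimplex.vertex (S := ℝ) i) = ContinuousMap.id _ := by
  ext t : 1
  refine Subtype.ext ?_
  change ∑ j, t j • (Pi.single j 1 : ι → ℝ) = t
  ext i
  simp [Finset.sum_apply, Pi.single_apply]

lemma affineSimplex_mem_closedBall {w : κ → stdSimplex ℝ ι} {x : stdSimplex ℝ ι} {r : ℝ}
    (h : ∀ j, w j ∈ Metric.closedBall x r) (t : stdSimplex ℝ κ) :
    affineSimplex w t ∈ Metric.closedBall x r :=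
  (convex_closedBall (x : ι → ℝ) r).sum_mem (fun j _ => stdSimplex.zero_le t j)
    (stdSimplex.sum_eq_one t) fun j _ => h j

/-- The barycenter of a tuple of points in a standard simplex. -/
noncomputable def bary (n : ℕ) (w : Fin (n + 1) → stdSimplex ℝ ι) : stdSimplex ℝ ι :=
  affineSimplex w stdSimplex.barycenter

lemma simplexMap_bary (f : ι → κ) (n : ℕ) (w : Fin (n + 1) → stdSimplex ℝ ι) :
    simplexMap f (bary n w) = bary n (simplexMap f ∘ w) := by
  rw [bary, bary, ← simplexMap_comp_affineSimplex]
  rfl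

lemma dist_bary_le (n : ℕ) (w : Fin (n + 1) → stdSimplex ℝ ι) (d : ℝ)
    (h : ∀ i j, dist (w i) (w j) ≤ d) (i : Fin (n + 1)) :
    dist (w i) (bary n w) ≤ n / (n + 1) * d := by
  have h0 : (n + 1 : ℝ) ≠ 0 := by positivity
  have h1 : ((w i).1 - (bary n w).1) =
      ((n : ℝ) + 1)⁻¹ • ∑ j, ((w i).1 - (w j).1) := by
    have h2 : (bary n w).1 = ((n : ℝ) + 1)⁻¹ • ∑ j, (w j).1 := by
      change ∑ j, (stdSimplex.barycenter : stdSimplex ℝ (Fin (n + 1))).1 j • (w j).1 = _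
      rw [Finset.smul_sum]
      refine Finset.sum_congr rfl fun j _ => ?_
      congr 1
      simp
    rw [h2, Finset.sum_sub_distrib, smul_sub, Finset.sum_const, Finset.card_univ, Fintype.card_fin,
      ← Nat.cast_smul_eq_nsmul ℝ, smul_smul]
    push_cast
    rw [inv_mul_cancel₀ h0, one_smul]
  rw [Subtype.dist_eq, dist_eq_norm, h1, norm_smul, Real.norm_of_nonneg (by positivity),
    div_mul_eq_mul_div, inv_mul_eq_div]
  gcongr
  -- The summand with index `i` vanishes, which leaves `n` summands of norm at most `d`.
  rw [Fin.sum_univ_succAbove _ i, sub_self, zero_add]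
  refine (norm_sum_le_of_le _ fun j _ => (?_ : _ ≤ d)).trans (by simp)
  rw [← dist_eq_norm]
  exact h i _

end AffineSimplex

/-! ### Subdivision of singular chains -/

namespace SingularChain

open Finsupp TupleChain

variable (R : Type*) [CommRing R] {X : Type*} [TopologicalSpace X]

/-- The vertices of the standard simplex of dimension `n`. -/
noncomputable def vertices (n : ℕ) : Fin (n + 1) → stdSimplex ℝ (Fin (n + 1)) :=
  fun i => stdSimplex.vertex i

/-- The singular boundary on formal combinations of continuous maps from standard simplices. -/
noncomputable def boundary (n : ℕ) :
    (C(stdSimplex ℝ (Fin (n + 2)), X) →₀ R) →ₗ[R] (C(stdSimplex ℝ (Fin (n + 1)), X) →₀ R) :=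
  ∑ i : Fin (n + 2), (-1 : R) ^ (i : ℕ) •
    lmapDomain R R (fun σ => σ.comp (simplexMap i.succAbove))

/-- The singular chain in `X` obtained from a chain of affine simplices in the standard simplex by
composition with a singular simplex. -/
noncomputable def push {n : ℕ} (σ : C(stdSimplex ℝ (Fin (n + 1)), X)) (k : ℕ) :
    ((Fin (k + 1) → stdSimplex ℝ (Fin (n + 1))) →₀ R) →ₗ[R]
      (C(stdSimplex ℝ (Fin (k + 1)), X) →₀ R) :=
  lmapDomain R R (fun w => σ.comp (affineSimplex w))

/-- The `m`-fold barycentric subdivision of singular chains. -/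
noncomputable def subdivision (m n : ℕ) : Module.End R (C(stdSimplex ℝ (Fin (n + 1)), X) →₀ R) :=
  linearCombination R fun σ =>
    push R σ n ((subdiv R (fun k w => bary k w) (n + 1) ^ m) (single (vertices n) 1))

/-- The chain homotopy between the identity and the `m`-fold barycentric subdivision. -/
noncomputable def homotopy (m n : ℕ) :
    (C(stdSimplex ℝ (Fin (n + 1)), X) →₀ R) →ₗ[R] (C(stdSimplex ℝ (Fin (n + 2)), X) →₀ R) :=
  linearCombination R fun σ =>
    push R σ (n + 1) (iterHomotopy R (fun k w => bary k w) m (n + 1) (single (vertices n) 1))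

variable {R}

lemma boundary_single {n : ℕ} (σ : C(stdSimplex ℝ (Fin (n + 2)), X)) (r : R) :
    boundary R n (single σ r) =
      ∑ i : Fin (n + 2), (-1 : R) ^ (i : ℕ) • single (σ.comp (simplexMap i.succAbove)) r := by
  simp [boundary]

@[simp]
lemma push_single {n : ℕ} (σ : C(stdSimplex ℝ (Fin (n + 1)), X)) {k : ℕ}
    (w : Fin (k + 1) → stdSimplex ℝ (Fin (n + 1))) (r : R) :
    push R σ k (single w r) = single (σ.comp (affineSimplex w)) r := by
  simp [push]

lemma push_vertices {n : ℕ} (σ : C(stdSimplex ℝ (Fin (n + 1)), X)) (r : R) :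
    push R σ n (single (vertices n) r) = single σ r := by
  rw [push_single]
  congr 1
  exact congrArg σ.comp affineSimplex_vertex

lemma boundary_push {n : ℕ} (σ : C(stdSimplex ℝ (Fin (n + 1)), X)) {k : ℕ}
    (c : (Fin (k + 2) → stdSimplex ℝ (Fin (n + 1))) →₀ R) :
    boundary R k (push R σ (k + 1) c) = push R σ k (TupleChain.boundary R (k + 1) c) := by
  induction c using Finsupp.induction_linear with
  | zero => simp
  | add c d hc hd => simp only [map_add, hc, hd]
  | single w r =>
    simp only [push_single, boundary_single, TupleChain.boundary_single, map_sum, map_smul,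
      ContinuousMap.comp_assoc, affineSimplex_comp_simplexMap]
    rfl

lemma push_map {n l : ℕ} (σ : C(stdSimplex ℝ (Fin (n + 1)), X)) (f : Fin (l + 1) → Fin (n + 1))
    {k : ℕ} (c : (Fin (k + 1) → stdSimplex ℝ (Fin (l + 1))) →₀ R) :
    push R σ k (TupleChain.map R (simplexMap f) (k + 1) c) =
      push R (σ.comp (simplexMap f)) k c := by
  induction c using Finsupp.induction_linear with
  | zero => simp
  | add c d hc hd => simp only [map_add, hc, hd]
  | single w r =>
    simp only [push_single, TupleChain.map_single, ContinuousMap.comp_assoc,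
      simplexMap_comp_affineSimplex]

lemma removeNth_vertices (n : ℕ) (i : Fin (n + 2)) :
    i.removeNth (vertices (n + 1)) = simplexMap i.succAbove ∘ vertices n := by
  funext j
  exact (stdSimplex.map_vertex _ _).symm

lemma sub_subdivision_zero (m : ℕ) (c : C(stdSimplex ℝ (Fin 1), X) →₀ R) :
    c - subdivision R m 0 c = boundary R 0 (homotopy R m 0 c) := by
  induction c using Finsupp.induction_linear with
  | zero => simp
  | add c d hc hd => simp only [map_add, ← hc, ← hd]; abel
  | single σ r =>
    have h := boundary_iterHomotopy (fun k (w : Fin (k + 1) → stdSimplex ℝ (Fin 1)) => bary k w) m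
      (single (vertices 0) (1 : R))
    rw [iterHomotopy_zero, LinearMap.zero_apply, add_zero] at h
    rw [subdivision, homotopy, linearCombination_single, linearCombination_single, map_smul,
      boundary_push, h, map_sub, push_vertices, smul_sub, smul_single_one]

lemma sub_subdivision_succ (m n : ℕ) (c : C(stdSimplex ℝ (Fin (n + 2)), X) →₀ R) :
    c - subdivision R m (n + 1) c =
      boundary R (n + 1) (homotopy R m (n + 1) c) + homotopy R m n (boundary R n c) := by
  induction c using Finsupp.induction_linear with
  | zero => simp
  | add c d hc hd =>
    simp only [map_add]
    rw [add_add_add_comm, ← hc, ← hd]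
    abel
  | single σ r =>
    have h := boundary_iterHomotopy
      (fun k (w : Fin (k + 1) → stdSimplex ℝ (Fin (n + 2))) => bary k w) m
      (single (vertices (n + 1)) (1 : R))
    rw [← eq_sub_iff_add_eq] at h
    have h2 : homotopy R m n (boundary R n (single σ r)) =
        r • push R σ (n + 1) (iterHomotopy R (fun k w => bary k w) m (n + 1)
          (TupleChain.boundary R (n + 1) (single (vertices (n + 1)) 1))) := by
      rw [boundary_single, TupleChain.boundary_single]
      simp only [map_sum, map_smul, Finset.smul_sum]
      refine Finset.sum_congr rfl fun i _ => ?_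
      rw [homotopy, linearCombination_single, ← push_map,
        map_iterHomotopy (γ := fun k w => bary k w) (simplexMap_bary i.succAbove),
        TupleChain.map_single, removeNth_vertices, smul_comm]
    rw [h2, subdivision, homotopy, linearCombination_single, linearCombination_single, map_smul,
      boundary_push, h, map_sub, map_sub, push_vertices, smul_sub, smul_sub, smul_single_one]
    abel

/-! ### Small simplices -/

/-- The simplices with values in a subset. -/
def simplicesIn (n : ℕ) (A : Set X) : Set C(stdSimplex ℝ (Fin (n + 1)), X) :=
  {σ | Set.range σ ⊆ A}

/-- Naturality of the homotopy: its value on a simplex lies in the image of that simplex. -/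
lemma homotopy_mem_supported (m : ℕ) {n : ℕ} {A B : Set X}
    {c : C(stdSimplex ℝ (Fin (n + 1)), X) →₀ R}
    (hc : c ∈ supported R R (simplicesIn n A ∪ simplicesIn n B)) :
    homotopy R m n c ∈ supported R R (simplicesIn (n + 1) A ∪ simplicesIn (n + 1) B) := by
  refine map_mem_of_mem_supported (fun σ hσ => ?_) hc
  rw [homotopy, linearCombination_single, one_smul]
  refine map_mem_of_mem_supported (s := Set.univ) (fun w _ => ?_) (by simp)
  rw [push_single]
  refine single_mem_supported R 1 (hσ.imp (fun h => ?_) fun h => ?_) <;>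
  exact (Set.range_comp_subset_range (affineSimplex w) σ).trans h

/-- Sufficiently fine subdivisions of a singular simplex only have simplices that lie in one of
two sets whose interiors cover the space. -/
lemma eventually_push_mem_supported {A B : Set X} (hAB : interior A ∪ interior B = Set.univ)
    {n : ℕ} (σ : C(stdSimplex ℝ (Fin (n + 1)), X)) :
    ∀ᶠ m in Filter.atTop,
      push R σ n ((subdiv R (fun k w => bary k w) (n + 1) ^ m) (single (vertices n) 1)) ∈
        supported R R (simplicesIn n A ∪ simplicesIn n B) := by
  obtain ⟨δ, hδ, hball⟩ := lebesgue_number_lemma_of_metric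
    (isCompact_univ (X := stdSimplex ℝ (Fin (n + 1))))
    (c := fun b : Bool => σ ⁻¹' interior (if b then A else B))
    (fun b => isOpen_interior.preimage σ.continuous) (by
      intro x _
      have hx : σ x ∈ interior A ∪ interior B := hAB ▸ Set.mem_univ _
      rw [Set.mem_iUnion]
      exact hx.elim (fun h => ⟨true, h⟩) fun h => ⟨false, h⟩)
  obtain ⟨d, hd⟩ := Metric.isBounded_iff.1
    (isCompact_univ (X := stdSimplex ℝ (Fin (n + 1)))).isBounded
  have hlim : Filter.Tendsto (fun m : ℕ => ((n : ℝ) / (n + 1)) ^ m * d) Filter.atTop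
      (nhds (0 * d)) :=
    (tendsto_pow_atTop_nhds_zero_of_lt_one (by positivity)
      ((div_lt_one (by positivity)).2 (lt_add_one _))).mul_const d
  rw [zero_mul] at hlim
  filter_upwards [hlim.eventually_lt_const hδ] with m hm
  have hsmall := subdiv_pow_mem_supported_of_dist (R := R)
    (β := fun k (w : Fin (k + 1) → stdSimplex ℝ (Fin (n + 1))) => bary k w)
    (fun x r k w hw => affineSimplex_mem_closedBall hw _) dist_bary_le m
    (single_mem_supported R (1 : R)
      (show vertices n ∈ {w | ∀ i j, dist (w i) (w j) ≤ d} from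
        fun i j => hd (Set.mem_univ _) (Set.mem_univ _)))
  refine map_mem_of_mem_supported (fun w hw => ?_) hsmall
  rw [push_single]
  refine single_mem_supported R 1 ?_
  obtain ⟨b, hb⟩ := hball (w 0) (Set.mem_univ _)
  have hr : Set.range (σ.comp (affineSimplex w)) ⊆ interior (if b then A else B) := by
    rintro _ ⟨t, rfl⟩
    refine hb (Metric.closedBall_subset_ball hm ?_)
    exact affineSimplex_mem_closedBall (fun j => hw j 0) t
  cases b
  · exact Or.inr (hr.trans interior_subset)
  · exact Or.inl (hr.trans interior_subset)

lemma exists_subdivision_mem_supported {A B : Set X}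
    (hAB : interior A ∪ interior B = Set.univ) {n : ℕ}
    (c : C(stdSimplex ℝ (Fin (n + 1)), X) →₀ R) :
    ∃ m, subdivision R m n c ∈ supported R R (simplicesIn n A ∪ simplicesIn n B) := by
  have h : ∀ᶠ m in Filter.atTop, ∀ σ ∈ c.support,
      push R σ n ((subdiv R (fun k w => bary k w) (n + 1) ^ m) (single (vertices n) 1)) ∈
        supported R R (simplicesIn n A ∪ simplicesIn n B) :=
    (Filter.eventually_all_finset _).2 fun σ _ => eventually_push_mem_supported hAB σ
  obtain ⟨m, hm⟩ := h.exists
  refine ⟨m, ?_⟩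
  rw [subdivision, linearCombination_apply]
  exact Submodule.sum_mem _ fun σ hσ => Submodule.smul_mem _ _ (hm σ hσ)

/-- Modulo chains whose simplices lie in `A` or in `B`, every `0`-chain is a boundary if the
interiors of `A` and `B` cover. -/
lemma exists_sub_boundary_mem_supported_zero {A B : Set X}
    (hAB : interior A ∪ interior B = Set.univ) (c : C(stdSimplex ℝ (Fin 1), X) →₀ R) :
    ∃ e, c - boundary R 0 e ∈ supported R R (simplicesIn 0 A ∪ simplicesIn 0 B) := by
  obtain ⟨m, hm⟩ := exists_subdivision_mem_supported hAB c
  refine ⟨homotopy R m 0 c, ?_⟩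
  rwa [← sub_subdivision_zero, sub_sub_cancel]

/-- Modulo chains whose simplices lie in `A` or in `B`, every cycle is a boundary if the interiors
of `A` and `B` cover. -/
lemma exists_sub_boundary_mem_supported_succ {A B : Set X}
    (hAB : interior A ∪ interior B = Set.univ) {n : ℕ}
    (c : C(stdSimplex ℝ (Fin (n + 2)), X) →₀ R)
    (hc : boundary R n c ∈ supported R R (simplicesIn n A ∪ simplicesIn n B)) :
    ∃ e, c - boundary R (n + 1) e ∈
      supported R R (simplicesIn (n + 1) A ∪ simplicesIn (n + 1) B) := by
  obtain ⟨m, hm⟩ := exists_subdivision_mem_supported hAB c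
  refine ⟨homotopy R m (n + 1) c, ?_⟩
  have h : c - boundary R (n + 1) (homotopy R m (n + 1) c) =
      homotopy R m n (boundary R n c) + subdivision R m (n + 1) c := by
    rw [sub_eq_iff_eq_add', ← add_assoc, ← sub_subdivision_succ, sub_add_cancel]
  rw [h]
  exact Submodule.add_mem _ (homotopy_mem_supported m hc) hm

end SingularChain

/-! ### Comparison with the singular chain complex -/

section Comparison

open Finsupp Simplicial Opposite

variable (K : Type v) [Field K]

/-- The functor of singular chains with coefficients in `K`, as used in the definition of relative
singular homology. -/
noncomputable abbrev singularChains : TopCat.{u} ⥤ ChainComplex (ModuleCat.{max u v} K) ℕ :=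
  (AlgebraicTopology.singularChainComplexFunctor.{u} (ModuleCat.{max u v} K)).obj
    (ModuleCat.of K (ULift.{u} K))

variable {X Y : TopCat.{u}}

/-- The singular simplex, as an element of the singular simplicial set, given by a continuous
map. -/
noncomputable def toSimplex {n : ℕ} (σ : C(stdSimplex ℝ (Fin (n + 1)), X)) :
    (TopCat.toSSet.obj X) _⦋n⦌ :=
  (X.toSSetObjEquiv (op ⦋n⦌)).symm σ

lemma toSimplex_bijective (X : TopCat.{u}) (n : ℕ) :
    Function.Bijective (toSimplex (X := X) (n := n)) :=
  (X.toSSetObjEquiv (op ⦋n⦌)).symm.bijective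

/-- The inclusion of the summand of the singular chains that corresponds to a singular simplex. -/
noncomputable def simplexInclusion {n : ℕ} (σ : C(stdSimplex ℝ (Fin (n + 1)), X)) :
    ModuleCat.of K (ULift.{u} K) ⟶ ((singularChains K).obj X).X n :=
  (TopCat.toSSet.obj X).ιChainComplex (toSimplex σ)

lemma simplexInclusion_map {n : ℕ} (f : X ⟶ Y) (σ : C(stdSimplex ℝ (Fin (n + 1)), X)) :
    simplexInclusion K σ ≫ ((singularChains K).map f).f n =
      simplexInclusion K (f.hom.comp σ) :=
  SSet.ι_chainComplexMap_f (TopCat.toSSet.obj X) (TopCat.toSSet.obj Y)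
      (TopCat.toSSet.map f) (ModuleCat.of K (ULift.{u} K)) (toSimplex σ)

/-- The faces of a singular simplex are, by definition, its composites with the inclusions of the
faces of the standard simplex. -/
lemma simplexInclusion_d {n : ℕ} (σ : C(stdSimplex ℝ (Fin (n + 2)), X)) :
    simplexInclusion K σ ≫ ((singularChains K).obj X).d (n + 1) n =
      ∑ i : Fin (n + 2), (-1) ^ (i : ℕ) •
        simplexInclusion K (σ.comp (simplexMap i.succAbove)) :=
  SSet.ιChainComplex_d (TopCat.toSSet.obj X) (ModuleCat.of K (ULift.{u} K)) (toSimplex σ)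

variable {K} in
lemma singularChains_hom_ext {n : ℕ} {M : ModuleCat.{max u v} K}
    {f g : ((singularChains K).obj X).X n ⟶ M}
    (h : ∀ σ, simplexInclusion K σ ≫ f = simplexInclusion K σ ≫ g) : f = g := by
  refine SSet.chainComplex_hom_ext (X := TopCat.toSSet.obj X)
    (R := ModuleCat.of K (ULift.{u} K)) fun x => ?_
  obtain ⟨σ, rfl⟩ := (toSimplex_bijective X n).2 x
  exact h σ

variable {K} in
lemma exists_singularChains_desc {n : ℕ} {M : ModuleCat.{max u v} K}
    (f : C(stdSimplex ℝ (Fin (n + 1)), X) → (ModuleCat.of K (ULift.{u} K) ⟶ M)) :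
    ∃ φ : ((singularChains K).obj X).X n ⟶ M, ∀ σ, simplexInclusion K σ ≫ φ = f σ := by
  refine ⟨Limits.Cofan.IsColimit.desc ((TopCat.toSSet.obj X).isColimitChainComplexXCofan
    (ModuleCat.of K (ULift.{u} K)) n) fun x => f (X.toSSetObjEquiv (op ⦋n⦌) x), fun σ => ?_⟩
  refine (Limits.Cofan.IsColimit.fac _ _ (toSimplex σ)).trans ?_
  exact congrArg f ((X.toSSetObjEquiv (op ⦋n⦌)).apply_symm_apply σ)

/-- The comparison map from formal combinations of continuous maps to singular chains. -/
noncomputable def toChain (X : TopCat.{u}) (n : ℕ) :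
    (C(stdSimplex ℝ (Fin (n + 1)), X) →₀ K) →ₗ[K] ((singularChains K).obj X).X n :=
  linearCombination K fun σ => (simplexInclusion K σ).hom ⟨1⟩

variable {K}

lemma toChain_single {n : ℕ} (σ : C(stdSimplex ℝ (Fin (n + 1)), X)) (r : K) :
    toChain K X n (single σ r) = (simplexInclusion K σ).hom ⟨r⟩ := by
  rw [toChain, linearCombination_single, ← map_smul]
  congr 1
  ext
  simp

lemma map_toChain {n : ℕ} (f : X ⟶ Y) (c : C(stdSimplex ℝ (Fin (n + 1)), X) →₀ K) :
    (((singularChains K).map f).f n).hom (toChain K X n c) =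
      toChain K Y n (lmapDomain K K f.hom.comp c) := by
  induction c using Finsupp.induction_linear with
  | zero => simp
  | add c d hc hd => simp only [map_add, hc, hd]
  | single σ r =>
    rw [lmapDomain_apply, mapDomain_single, toChain_single, toChain_single,
      ← simplexInclusion_map]
    rfl

lemma d_toChain {n : ℕ} (c : C(stdSimplex ℝ (Fin (n + 2)), X) →₀ K) :
    (((singularChains K).obj X).d (n + 1) n).hom (toChain K X (n + 1) c) =
      toChain K X n (SingularChain.boundary K n c) := by
  induction c using Finsupp.induction_linear with
  | zero => simp
  | add c d hc hd => simp only [map_add, hc, hd]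
  | single σ r =>
    rw [SingularChain.boundary_single, toChain_single, map_sum]
    refine congr($(simplexInclusion_d K σ).hom ⟨r⟩).trans ?_
    rw [ModuleCat.hom_sum, LinearMap.sum_apply]
    refine Finset.sum_congr rfl fun i _ => ?_
    rw [map_smul, toChain_single]
    rw [show (-1 : K) ^ (i : ℕ) = (((-1 : ℤ) ^ (i : ℕ) : ℤ) : K) by simp,
      Int.cast_smul_eq_zsmul]
    rfl

lemma toChain_bijective (X : TopCat.{u}) (n : ℕ) : Function.Bijective (toChain K X n) := by
  obtain ⟨φ, hφ⟩ := exists_singularChains_desc (X := X) (n := n)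
    (M := ModuleCat.of K (C(stdSimplex ℝ (Fin (n + 1)), X) →₀ K))
    fun σ => ModuleCat.ofHom (lsingle σ ∘ₗ ULift.moduleEquiv.toLinearMap)
  refine ⟨Function.LeftInverse.injective (g := φ.hom) fun c => ?_,
    Function.RightInverse.surjective (g := φ.hom) fun c => ?_⟩
  · induction c using Finsupp.induction_linear with
    | zero => simp
    | add c d hc hd => simp only [map_add, hc, hd]
    | single σ r =>
      rw [toChain_single]
      exact congr($(hφ σ).hom ⟨r⟩)
  · have : φ ≫ ModuleCat.ofHom (toChain K X n) = 𝟙 _ := by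
      refine singularChains_hom_ext fun σ => ?_
      rw [reassoc_of% (hφ σ), Category.comp_id]
      ext r
      exact toChain_single σ r.down
    exact congr($(this).hom c)

end Comparison

/-! ### Cokernels of chain maps of modules -/

section Homological

open Limits

variable {R : Type*} [Ring R] {ι : Type*} {s : ComplexShape ι}

lemma cokernel_π_f_surjective {X Y : HomologicalComplex (ModuleCat.{w} R) s} (f : X ⟶ Y) (j : ι) :
    Function.Surjective ((cokernel.π f).f j).hom :=
  (ModuleCat.epi_iff_surjective _).1
    (inferInstanceAs (Epi ((HomologicalComplex.eval _ s j).map (cokernel.π f))))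

lemma cokernel_π_f_eq_zero_iff {X Y : HomologicalComplex (ModuleCat.{w} R) s} (f : X ⟶ Y) {j : ι}
    (y : Y.X j) : ((cokernel.π f).f j).hom y = 0 ↔ y ∈ LinearMap.range (f.f j).hom := by
  have h : (ShortComplex.mk f (cokernel.π f) (cokernel.condition f)).Exact :=
    ShortComplex.exact_cokernel f
  have h2 := (HomologicalComplex.exact_iff_degreewise_exact _).1 h j
  rw [ShortComplex.moduleCat_exact_iff_range_eq_ker] at h2
  change LinearMap.range (f.f j).hom = LinearMap.ker ((cokernel.π f).f j).hom at h2
  rw [h2, LinearMap.mem_ker]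

/-- An injective chain map whose cokernel is acyclic is a quasi-isomorphism. -/
lemma isIso_homologyMap_of_acyclic_cokernel {X Y : HomologicalComplex (ModuleCat.{w} R) s}
    (f : X ⟶ Y) [Mono f] (h : (cokernel f).Acyclic) (j : ι) :
    IsIso (HomologicalComplex.homologyMap f j) := by
  have hS : (ShortComplex.mk f (cokernel.π f) (cokernel.condition f)).ShortExact :=
    { exact := ShortComplex.exact_cokernel f }
  have hepi : Epi (HomologicalComplex.homologyMap f j) :=
    hS.homology_exact₂ j |>.epi_f ((h j).isZero_homology.eq_of_tgt _ _)
  have hmono : Mono (HomologicalComplex.homologyMap f j) := by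
    by_cases hj : s.Rel (s.prev j) j
    · exact (hS.homology_exact₁ _ j hj).mono_g ((h _).isZero_homology.eq_of_src _ _)
    · -- Without a differential into degree `j`, the homology is the submodule of cycles.
      have (Z : HomologicalComplex (ModuleCat.{w} R) s) : IsIso (Z.homologyπ j) :=
        ShortComplex.isIso_homologyπ (Z.sc j) (Z.shape _ _ hj)
      have h1 := HomologicalComplex.homologyπ_naturality f j
      rw [← IsIso.eq_inv_comp] at h1
      rw [h1]
      infer_instance
  exact isIso_of_mono_of_epi _

/-- The map on cokernels induced by a commutative square with parallel maps `f` and `g` is a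
quasi-isomorphism if every chain that `v` sends into the image of `g` lies in the image of `f`, and
if, modulo the images of `g` and `v`, every cycle of the target is a boundary. In
degree `0` the differential `Y'.d 0 (0 - 1)` is zero, so there every chain counts as a cycle. -/
lemma isIso_homologyMap_cokernel {X Y X' Y' : ChainComplex (ModuleCat.{w} R) ℕ}
    {f : X ⟶ Y} {g : X' ⟶ Y'} (v : Y ⟶ Y') (ψ : cokernel f ⟶ cokernel g)
    (hψ : cokernel.π f ≫ ψ = v ≫ cokernel.π g)
    (hinj : ∀ (n : ℕ) (y : Y.X n), (v.f n).hom y ∈ LinearMap.range (g.f n).hom →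
      y ∈ LinearMap.range (f.f n).hom)
    (hacyc : ∀ (n : ℕ) (y : Y'.X n),
      (Y'.d n (n - 1)).hom y ∈
        LinearMap.range (g.f (n - 1)).hom ⊔ LinearMap.range (v.f (n - 1)).hom →
      ∃ e : Y'.X (n + 1), y - (Y'.d (n + 1) n).hom e ∈
        LinearMap.range (g.f n).hom ⊔ LinearMap.range (v.f n).hom) (n : ℕ) :
    IsIso (HomologicalComplex.homologyMap ψ n) := by
  have hψ' (n : ℕ) (y : Y.X n) : (ψ.f n).hom (((cokernel.π f).f n).hom y) =
      ((cokernel.π g).f n).hom ((v.f n).hom y) :=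
    congr(($(hψ).f n).hom y)
  have hmono : Mono ψ := by
    refine HomologicalComplex.mono_of_mono_f _ fun n => ?_
    rw [ModuleCat.mono_iff_injective, injective_iff_map_eq_zero]
    intro x hx
    obtain ⟨y, rfl⟩ := cokernel_π_f_surjective f n x
    rw [hψ', cokernel_π_f_eq_zero_iff] at hx
    exact (cokernel_π_f_eq_zero_iff _ _).2 (hinj n y hx)
  -- The projection of the target of the square onto the cokernel of `ψ`.
  let q (n : ℕ) : Y'.X n → (cokernel ψ).X n :=
    fun y => ((cokernel.π ψ).f n).hom (((cokernel.π g).f n).hom y)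
  have hq (n : ℕ) (y : Y'.X n) : q n y = 0 ↔
      y ∈ LinearMap.range (g.f n).hom ⊔ LinearMap.range (v.f n).hom := by
    rw [cokernel_π_f_eq_zero_iff, Submodule.mem_sup]
    constructor
    · rintro ⟨x, hx⟩
      obtain ⟨z, rfl⟩ := cokernel_π_f_surjective f n x
      rw [hψ', eq_comm, ← sub_eq_zero, ← map_sub, cokernel_π_f_eq_zero_iff] at hx
      exact ⟨_, hx, _, ⟨z, rfl⟩, sub_add_cancel _ _⟩
    · rintro ⟨a, ha, _, ⟨z, rfl⟩, rfl⟩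
      rw [map_add, (cokernel_π_f_eq_zero_iff _ a).2 ha, zero_add, ← hψ']
      exact ⟨_, rfl⟩
  have hqd (i j : ℕ) (y : Y'.X i) :
      q j ((Y'.d i j).hom y) = ((cokernel ψ).d i j).hom (q i y) :=
    congr(($((cokernel.π g ≫ cokernel.π ψ).comm i j)).hom y).symm
  refine isIso_homologyMap_of_acyclic_cokernel _ (fun n => ?_) n
  rw [HomologicalComplex.exactAt_iff' _ (n + 1) n (n - 1) (by simp) (by cases n <;> simp),
    ShortComplex.moduleCat_exact_iff]
  intro x hx
  obtain ⟨y, rfl⟩ : ∃ y, q n y = x :=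
    ((cokernel_π_f_surjective ψ n).comp (cokernel_π_f_surjective g n)) x
  replace hx : ((cokernel ψ).d n (n - 1)).hom (q n y) = 0 := hx
  rw [← hqd, hq] at hx
  obtain ⟨e, he⟩ := hacyc n y hx
  refine ⟨q _ e, (hqd _ _ e).symm.trans ?_⟩
  rw [← hq] at he
  simp only [q, map_sub, sub_eq_zero] at he
  exact he.symm

end Homological

/-! ### Excision for pairs of spaces -/

section Excision

open Finsupp Limits SingularChain

variable {K : Type v} [Field K]

/-- The image of the singular chains under an embedding consists of the chains whose simplices lie
in the range of the embedding. -/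
lemma toChain_mem_range_map_iff {X Y : TopCat.{u}} (f : X ⟶ Y) (hf : Topology.IsEmbedding f)
    {n : ℕ} (c : C(stdSimplex ℝ (Fin (n + 1)), Y) →₀ K) :
    toChain K Y n c ∈ LinearMap.range (((singularChains K).map f).f n).hom ↔
      c ∈ supported K K (simplicesIn n (Set.range f)) := by
  have h : LinearMap.range (lmapDomain K K f.hom.comp) =
      supported K K (simplicesIn n (Set.range f)) := by
    rw [range_lmapDomain, supported_eq_span_single]
    congr 1
    ext x
    constructor
    · rintro ⟨σ, rfl⟩
      exact ⟨f.hom.comp σ, Set.range_comp_subset_range σ f.hom, rfl⟩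
    · rintro ⟨τ, hτ, rfl⟩
      choose σ hσ using fun t => hτ (Set.mem_range_self t)
      have hc : f ∘ σ = τ := funext hσ
      refine ⟨⟨σ, hf.continuous_iff.2 (hc ▸ τ.continuous)⟩, ?_⟩
      exact congrArg (fun σ => single σ (1 : K)) (ContinuousMap.ext hσ)
  rw [← h]
  constructor
  · rintro ⟨b, hb⟩
    obtain ⟨b, rfl⟩ := (toChain_bijective X n).2 b
    rw [map_toChain] at hb
    exact ⟨b, (toChain_bijective Y n).1 hb⟩
  · rintro ⟨b, rfl⟩
    exact ⟨_, map_toChain f b⟩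

/-- Excision: a map of pairs `(B, A ∩ B) ⟶ (X, A)` induces isomorphisms on relative homology
if the interiors of `A` and `B` cover `X`. Here `X` is the larger space of `Q`, and its subspaces
`A` and `B` are the images of the smaller space of `Q` and of the larger space of `P`. -/
theorem isIso_relHomologyFunctor_map {P Q : TopPair.{u}} (f : P ⟶ Q)
    (hf : Topology.IsEmbedding (TopPair.Hom.fst f))
    (hinter : Set.range (P.map ≫ TopPair.Hom.fst f) =
      Set.range Q.map ∩ Set.range (TopPair.Hom.fst f))
    (hcover : interior (Set.range Q.map) ∪ interior (Set.range (TopPair.Hom.fst f)) = Set.univ)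
    (k : ℕ) :
    IsIso ((relHomologyFunctor K k).map f) := by
  let φ := (singularChains K).mapArrow.map ((MorphismProperty.Arrow.forget _ _ _).map f)
  have hφ (n : ℕ) (c : C(stdSimplex ℝ (Fin (n + 1)), Q.fst) →₀ K) :
      toChain K Q.fst n c ∈ LinearMap.range (((singularChains K).map Q.map).f n).hom ⊔
        LinearMap.range (((singularChains K).map (TopPair.Hom.fst f)).f n).hom ↔
      c ∈ supported K K (simplicesIn n (Set.range Q.map) ∪
        simplicesIn n (Set.range (TopPair.Hom.fst f))) := by
    have hb := toChain_bijective (K := K) Q.fst n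
    have h1 : (LinearMap.range (((singularChains K).map Q.map).f n).hom).comap (toChain K _ n) =
        supported K K (simplicesIn n (Set.range Q.map)) :=
      Submodule.ext fun c => toChain_mem_range_map_iff Q.map Q.isEmbedding_map c
    have h2 : (LinearMap.range (((singularChains K).map (TopPair.Hom.fst f)).f n).hom).comap
        (toChain K _ n) = supported K K (simplicesIn n (Set.range (TopPair.Hom.fst f))) :=
      Submodule.ext fun c => toChain_mem_range_map_iff _ hf c
    have ht := LinearMap.range_eq_top.2 hb.2
    rw [supported_union, ← h1, ← h2, ← Submodule.comap_sup_of_injective hb.1 (ht ▸ le_top)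
      (ht ▸ le_top)]
    rfl
  refine isIso_homologyMap_cokernel φ.right ((coker _).map φ) (cokernel.π_desc _ _ _)
    (fun n b hb => ?_) (fun n y hy => ?_) k
  · -- A chain of `B` whose simplices lie in `A` is a chain of `A ∩ B`.
    obtain ⟨b, rfl⟩ := (toChain_bijective P.fst n).2 b
    change toChain K P.fst n b ∈ LinearMap.range (((singularChains K).map P.map).f n).hom
    change (((singularChains K).map (TopPair.Hom.fst f)).f n).hom (toChain K P.fst n b) ∈
      LinearMap.range (((singularChains K).map Q.map).f n).hom at hb
    rw [toChain_mem_range_map_iff _ P.isEmbedding_map]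
    rw [map_toChain, toChain_mem_range_map_iff _ Q.isEmbedding_map] at hb
    rw [mem_supported] at hb ⊢
    intro σ hσ
    have hfσ : (TopPair.Hom.fst f).hom.comp σ ∈ simplicesIn n (Set.range Q.map) := by
      refine hb (Finset.mem_coe.2 (mem_support_iff.2 ?_))
      rw [lmapDomain_apply, mapDomain_apply
        (fun _ _ h => ContinuousMap.ext fun t => hf.injective (DFunLike.congr_fun h t))]
      exact mem_support_iff.1 hσ
    rintro _ ⟨t, rfl⟩
    have ht : TopPair.Hom.fst f (σ t) ∈ Set.range (P.map ≫ TopPair.Hom.fst f) :=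
      hinter ▸ ⟨hfσ ⟨t, rfl⟩, Set.mem_range_self _⟩
    obtain ⟨a, ha⟩ := ht
    exact ⟨a, hf.injective ha⟩
  · -- Barycentric subdivision makes the relative cycles modulo `C(A) + C(B)` boundaries.
    obtain ⟨c, rfl⟩ := (toChain_bijective Q.fst n).2 y
    have key : ∃ e, c - SingularChain.boundary K n e ∈ supported K K
        (simplicesIn n (Set.range Q.map) ∪ simplicesIn n (Set.range (TopPair.Hom.fst f))) := by
      cases n with
      | zero => exact exists_sub_boundary_mem_supported_zero hcover c
      | succ n =>
        refine exists_sub_boundary_mem_supported_succ hcover c ((hφ n _).1 ?_)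
        rw [← d_toChain]
        exact hy
    obtain ⟨e, he⟩ := key
    rw [← hφ, map_sub, ← d_toChain] at he
    exact ⟨_, he⟩

/-- Excision for pairs of subspaces of a fixed space. -/
lemma isIso_relHomologyFunctor_map_subPair {X : Type u} [TopologicalSpace X] {p q : SubPair X}
    (h : p ≤ q) (hinter : p.1.2 = q.1.2 ∩ p.1.1)
    (hcover : interior ((↑) ⁻¹' q.1.2 : Set q.1.1) ∪ interior ((↑) ⁻¹' p.1.1 : Set q.1.1) =
      Set.univ) (k : ℕ) :
    IsIso ((relHomologyFunctor K k).map ((SubPair.toTopPair X).map (homOfLE h))) := by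
  have h1 : Set.range ((SubPair.toTopPair X).obj q).map = ((↑) ⁻¹' q.1.2 : Set q.1.1) :=
    Set.range_inclusion q.2
  have h2 : Set.range (TopPair.Hom.fst ((SubPair.toTopPair X).map (homOfLE h))) =
      ((↑) ⁻¹' p.1.1 : Set q.1.1) :=
    Set.range_inclusion h.1
  refine isIso_relHomologyFunctor_map _ (Topology.IsEmbedding.inclusion h.1) ?_
    (by rwa [h1, h2]) k
  rw [h1, h2]
  refine (Set.range_inclusion (p.2.trans h.1)).trans ?_
  change (Subtype.val ⁻¹' p.1.2 : Set q.1.1) = _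
  rw [hinter]
  rfl

end Excision

end PersistentExcision

open PersistentExcision in
theorem mainTheorem1 (K : Type v) [Field K] {P : Type w} [PartialOrder P]
    {X : Type u} [TopologicalSpace X] (hX : IsTriangulable X)
    (A B : Set X) (hA : A.Nonempty) (hB : B.Nonempty)
    (hAB : interior A ∪ interior B = Set.univ)
    (FX : Filtration P (Set.univ : Set X)) (FA : Filtration P A) (FB : Filtration P B)
    (hFA : ∀ i, FA.stage i ⊆ FX.stage i) (hFB : ∀ i, FB.stage i ⊆ FX.stage i)
    (hcover : ∀ i, interior ((↑) ⁻¹' FA.stage i : Set (FX.stage i)) ∪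
      interior ((↑) ⁻¹' FB.stage i : Set (FX.stage i)) = Set.univ)
    (k : ℕ) :
    IsIso (relPersistenceModuleMap K k (FX.pair_inter_le FA FB hFA hFB)) ∧
    ∀ (i j : WithTop P) (hij : i < j),
      ∃ e : persistentGroup (relPersistenceModule K k
              (FB.pair (FA.inter FB) Set.inter_subset_right
                (fun _ => Set.inter_subset_right))) hij.le ≃ₗ[K]
            persistentGroup (relPersistenceModule K k
              (FX.pair FA (Set.subset_univ A) hFA)) hij.le,
        ∀ y, (e y : (relPersistenceModule K k (FX.pair FA (Set.subset_univ A) hFA)).obj j) =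
          ((relPersistenceModuleMap K k (FX.pair_inter_le FA FB hFA hFB)).app j).hom y := by
  have hiso : IsIso (relPersistenceModuleMap K k (FX.pair_inter_le FA FB hFA hFB)) := by
    have happ (i : WithTop P) :
        IsIso ((relPersistenceModuleMap K k (FX.pair_inter_le FA FB hFA hFB)).app i) := by
      refine isIso_relHomologyFunctor_map_subPair (FX.pair_inter_le FA FB hFA hFB i) ?_ ?_ k
      · induction i using WithTop.recTopCoe <;> rfl
      · induction i using WithTop.recTopCoe with
        | top =>
          have hval : IsOpenMap (Subtype.val : ↥(Set.univ : Set X) → X) :=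
            isOpen_univ.isOpenMap_subtype_val
          change interior (Subtype.val ⁻¹' A : Set (Set.univ : Set X)) ∪
            interior (Subtype.val ⁻¹' B : Set (Set.univ : Set X)) = Set.univ
          rw [← hval.preimage_interior_eq_interior_preimage continuous_subtype_val,
            ← hval.preimage_interior_eq_interior_preimage continuous_subtype_val,
            ← Set.preimage_union, hAB, Set.preimage_univ]
        | coe i => exact hcover i
    exact NatIso.isIso_of_isIso_app _
  refine ⟨hiso, fun i j hij => ?_⟩
  let φ := relPersistenceModuleMap K k (FX.pair_inter_le FA FB hFA hFB)
  let ε (i : WithTop P) := ((asIso φ).app i).toLinearEquiv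
  refine ⟨(ε j).ofSubmodules _ _ ?_, fun y => rfl⟩
  rw [persistentGroup, persistentGroup, ← LinearMap.range_comp]
  have hnat : (relPersistenceModule K k _).map (homOfLE hij.le) ≫ φ.app j =
    φ.app i ≫ (relPersistenceModule K k _).map (homOfLE hij.le) := φ.naturality _
  have := congrArg ModuleCat.Hom.hom hnat
  refine (congrArg LinearMap.range this).trans ?_
  exact LinearMap.range_comp_of_range_eq_top _ (ε i).range
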